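/- Let $R$ be a $3$-dimensional regular local ring whose maximal ideal $\mathfrak m$ is generated by $x, y, z$. Let $I$ be the ideal of $R$ generated by the maximal ($2\times 2$) minors of the matrix $$\begin{pmatrix} x & y & z \\ y & z & x^2 \end{pmatrix}.$$ For $n \ge 1$ let $I^{(n)} = \bigcap_{\mathfrak p} (I^n R_{\mathfrak p} \cap R)$ be the $n$-th symbolic power of $I$, where $\mathfrak p$ runs over the minimal prime ideals of $I$ and $I^n R_{\mathfrak p} \cap R$ denotes the preimage of $I^n R_{\mathfrak p}$ in $R$. Then for every integer $n \ge 1$, with $q = \lfloor n/2 \rfloor$, $$\operatorname{depth}_R R/(I^n :_R \mathfrak m^q) > 0 \quad\text{and}\quad I^{(n)} = I^n :_R \mathfrak m^q .$$ -/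

import Mathlib

/-- The ideal generated by the `t × t` minors of a matrix `A` (rows and columns of each
submatrix are kept in increasing order). -/
def minorsIdeal {R : Type*} [CommRing R] {m n : ℕ} (t : ℕ) (A : Matrix (Fin m) (Fin n) R) :
    Ideal R :=
  Ideal.span {d : R | ∃ (r : Fin t ↪o Fin m) (c : Fin t ↪o Fin n), d = (A.submatrix r c).det}

/-- The `n`-th symbolic power of `I`: the intersection, over the minimal primes `p` of `R ⧸ I`,
of the contractions to `R` of `I ^ n R_p`. -/
def symbolicPower {R : Type*} [CommRing R] (I : Ideal R) (n : ℕ) : Ideal R :=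
  ⨅ (p : PrimeSpectrum R) (_ : p.asIdeal ∈ I.minimalPrimes),
    ((I ^ n).map (algebraMap R (Localization.AtPrime p.asIdeal))).comap
      (algebraMap R (Localization.AtPrime p.asIdeal))

open Classical in
/-- The depth of a module `M` over a local ring `(R, 𝔪)`: the supremum of the lengths of the
`M`-regular sequences contained in `𝔪`, with the usual convention that the depth is `∞` if
`𝔪 M = M` (for finitely generated `M`, if `M = 0`). -/
noncomputable def localDepth (R : Type*) [CommRing R] [IsLocalRing R]
    (M : Type*) [AddCommGroup M] [Module R M] : ℕ∞ :=
  if IsLocalRing.maximalIdeal R • (⊤ : Submodule R M) = ⊤ then ⊤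
  else ⨆ (rs : List R) (_ : RingTheory.Sequence.IsRegular M rs ∧
    ∀ r ∈ rs, r ∈ IsLocalRing.maximalIdeal R), (rs.length : ℕ∞)

/-! Write a = y² - xz, b = yz - x³, c = z² - x²y for the minors up to sign. Modulo x they become y²,
yz, z², so b² - ac is divisible by x; the quotient d satisfies 𝔪d ⊆ I². Let J n be the sum of the
ideals d^i I^(n-2i). Each factor d costs one factor of 𝔪, hence J n ⊆ Iⁿ : 𝔪^q
(`degreeTwoFiltration_mul_pow_le`).

The heart is that x is a nonzerodivisor modulo J n (`exists_mem_degreeTwoFiltration_of_dvd`). It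
rests on a small generating set of J n modulo x J n (`degreeTwoFiltration_le`) and on the two linear
syzygies of a, b, c.

Since 𝔪 is the only prime containing I and x, some power of x carries any element of I⁽ⁿ⁾ into Iⁿ ⊆
J n; cancelling x gives I⁽ⁿ⁾ ⊆ J n (`symbolicPower_le`). As 𝔪 is not minimal over I, x avoids the
minimal primes, so Iⁿ : 𝔪^q ⊆ I⁽ⁿ⁾. The three ideals agree, and x witnesses positive depth. -/

/-! ### Regular local rings: primes generated by part of a system of parameters -/

open IsLocalRing in
/-- Powers of `b` move `a` out of every prime of a finite set not containing both `a` and `b`. -/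
theorem exists_forall_add_pow_mem_imp {R : Type*} [CommRing R] [IsLocalRing R]
    {S : Set (Ideal R)} (hS : S.Finite) (hprime : ∀ Q ∈ S, Q.IsPrime) (a : R) {b : R}
    (hb : b ∈ maximalIdeal R) :
    ∃ k : ℕ, ∀ Q ∈ S, a + b ^ (k + 1) ∈ Q → a ∈ Q ∧ b ∈ Q := by
  by_contra! H
  choose f hfS hf hf' using H
  have := hS.to_subtype
  -- Pigeonhole: two exponents share a prime, and the difference of the two elements is a power of
  -- `b` times a unit.
  obtain ⟨k, l, hkl, heq⟩ :=
    Finite.exists_ne_map_eq_of_infinite (fun k => (⟨f k, hfS k⟩ : S))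
  have heq : f k = f l := congrArg Subtype.val heq
  wlog hlt : k < l generalizing k l
  · exact this l k hkl.symm (Subtype.ext heq.symm) heq.symm (by omega)
  have hQ := hprime _ (hfS k)
  obtain ⟨j, rfl⟩ := Nat.exists_eq_add_of_lt hlt
  have h1 : b ^ (k + 1) * (1 - b ^ (j + 1)) ∈ f k := by
    have := (f k).sub_mem (hf k) (heq ▸ hf (k + j + 1))
    convert this using 1
    ring
  have hu : IsUnit (1 - b ^ (j + 1)) := by
    by_contra hn
    have h2 : 1 - b ^ (j + 1) ∈ maximalIdeal R := hn
    have h3 := (maximalIdeal R).add_mem h2 (Ideal.pow_mem_of_mem _ hb (j + 1) (by omega))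
    rw [sub_add_cancel] at h3
    exact (Ideal.ne_top_iff_one _).1 (maximalIdeal.isMaximal R).ne_top h3
  have hbk : b ^ (k + 1) ∈ f k := (Ideal.mul_unit_mem_iff_mem _ hu).1 h1
  have ha : a ∈ f k := by simpa using (f k).sub_mem (hf k) hbk
  exact hf' k ha (hQ.mem_of_pow_mem _ hbk)

open IsLocalRing in
theorem exists_mem_ofList_forall_add_mem_imp {R : Type*} [CommRing R] [IsLocalRing R]
    {S : Set (Ideal R)} (hS : S.Finite) (hprime : ∀ Q ∈ S, Q.IsPrime) (a : R) (l : List R)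
    (hl : ∀ b ∈ l, b ∈ maximalIdeal R) :
    ∃ c ∈ Ideal.ofList l, ∀ Q ∈ S, a + c ∈ Q → a ∈ Q ∧ ∀ b ∈ l, b ∈ Q := by
  induction l with
  | nil => exact ⟨0, by simp, by simp⟩
  | cons b t ih =>
    obtain ⟨c, hc, hcQ⟩ := ih fun r hr => hl r (List.mem_cons_of_mem _ hr)
    obtain ⟨k, hk⟩ := exists_forall_add_pow_mem_imp hS hprime (a + c) (hl b List.mem_cons_self)
    refine ⟨c + b ^ (k + 1), ?_, fun Q hQ h => ?_⟩
    · rw [Ideal.ofList_cons]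
      exact add_mem (Ideal.mem_sup_right hc) (Ideal.mem_sup_left
        (Ideal.pow_mem_of_mem _ (Ideal.mem_span_singleton_self b) _ (by omega)))
    · obtain ⟨h1, h2⟩ := hk Q hQ (by rwa [add_assoc])
      obtain ⟨h3, h4⟩ := hcQ Q hQ h1
      exact ⟨h3, by simpa using ⟨h2, h4⟩⟩

-- A minimal prime Q inside (x) that misses x satisfies Q = xQ, so Nakayama gives Q = 0.
open IsLocalRing in
theorem isDomain_of_isPrime_span_singleton {R : Type*} [CommRing R] [IsLocalRing R]
    [IsNoetherianRing R] {x : R} (hx : (Ideal.span {x}).IsPrime)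
    (hmin : ∀ Q ∈ minimalPrimes R, x ∉ Q) : IsDomain R := by
  obtain ⟨Q, hQ, hle⟩ := Ideal.exists_minimalPrimes_le (bot_le : (⊥ : Ideal R) ≤ Ideal.span {x})
  have hQp : Q.IsPrime := hQ.1.1
  have hbot : Q = ⊥ := by
    refine Submodule.eq_bot_of_le_smul_of_le_jacobson_bot (maximalIdeal R) Q
      (IsNoetherian.noetherian Q) (fun q hq => ?_) (maximalIdeal_le_jacobson _)
    obtain ⟨r, rfl⟩ := Ideal.mem_span_singleton'.1 (hle hq)
    have hr : r ∈ Q := (hQp.mem_or_mem hq).resolve_right (hmin Q hQ)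
    rw [mul_comm, smul_eq_mul]
    exact Ideal.mul_mem_mul
      (le_maximalIdeal hx.ne_top (Ideal.mem_span_singleton_self x)) hr
  subst hbot
  exact IsDomain.of_bot_isPrime R

open IsLocalRing in
theorem maximalIdeal_quotient_ofList {R : Type*} [CommRing R] [IsLocalRing R]
    [IsNoetherianRing R] {l₁ l₂ : List R} (h : maximalIdeal R = Ideal.ofList (l₁ ++ l₂)) {d : ℕ}
    (hd : ((l₁.length + d : ℕ) : WithBot ℕ∞) ≤ ringKrullDim R) :
    ∃ _ : IsLocalRing (R ⧸ Ideal.ofList l₁),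
      maximalIdeal (R ⧸ Ideal.ofList l₁) =
          Ideal.ofList (l₂.map (Ideal.Quotient.mk (Ideal.ofList l₁))) ∧
        (d : WithBot ℕ∞) ≤ ringKrullDim (R ⧸ Ideal.ofList l₁) := by
  have hle : Ideal.ofList l₁ ≤ maximalIdeal R := by
    rw [h, Ideal.ofList_append]; exact le_sup_left
  have hnt : Nontrivial (R ⧸ Ideal.ofList l₁) := Ideal.Quotient.nontrivial_iff.2
    fun ht => (maximalIdeal.isMaximal R).ne_top (top_le_iff.1 (ht ▸ hle))
  have hloc : IsLocalRing (R ⧸ Ideal.ofList l₁) :=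
    .of_surjective' (Ideal.Quotient.mk _) Ideal.Quotient.mk_surjective
  refine ⟨hloc, ?_, ?_⟩
  · have hmap : (maximalIdeal R).map (Ideal.Quotient.mk (Ideal.ofList l₁)) =
        maximalIdeal (R ⧸ Ideal.ofList l₁) :=
      map_maximalIdeal_of_surjective _ Ideal.Quotient.mk_surjective
    rw [← hmap, h, Ideal.ofList_append, Ideal.map_sup, Ideal.map_ofList, Ideal.map_ofList]
    refine sup_eq_right.2 ?_
    rw [← Ideal.map_ofList, Ideal.map_quotient_self]
    exact bot_le
  · have h1 := ringKrullDim_le_ringKrullDim_quotient_add_encard {r | r ∈ l₁}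
      (fun r hr => by
        rw [ringJacobson_eq_maximalIdeal R]
        exact hle (Ideal.subset_span hr))
    have h2 : Set.encard {r | r ∈ l₁} ≤ l₁.length := by
      classical
      rw [← List.coe_toFinset, Set.encard_coe_eq_coe_finsetCard]
      exact_mod_cast l₁.toFinset_card_le
    have h3 := hd.trans h1
    change _ ≤ ringKrullDim (R ⧸ Ideal.ofList l₁) + _ at h3
    obtain ⟨e, he⟩ := WithBot.ne_bot_iff_exists.1 (ringKrullDim_ne_bot (R := R ⧸ Ideal.ofList l₁))
    rw [← he] at h3 ⊢
    have h4 : ((l₁.length + d : ℕ) : ℕ∞) ≤ e + Set.encard {r | r ∈ l₁} := by exact_mod_cast h3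
    have h5 : ((l₁.length : ℕ∞) + d) ≤ l₁.length + e := by
      calc _ ≤ _ := by exact_mod_cast h4
        _ ≤ e + l₁.length := by gcongr
        _ = _ := add_comm _ _
    have h6 : (d : ℕ∞) ≤ e := (ENat.add_le_add_iff_left (ENat.natCast_ne_top _)).1 h5
    exact_mod_cast h6

open IsLocalRing in
/-- A Noetherian local ring whose maximal ideal is generated by `dim R` elements is a domain. -/
theorem isDomain_of_maximalIdeal_eq_ofList {R : Type*} [CommRing R] [IsLocalRing R]
    [IsNoetherianRing R] (l : List R) (h : maximalIdeal R = Ideal.ofList l)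
    (hd : (l.length : WithBot ℕ∞) ≤ ringKrullDim R) : IsDomain R := by
  generalize hn : l.length = n at hd
  induction n generalizing R with
  | zero =>
    obtain rfl := List.length_eq_zero_iff.1 hn
    exact (isField_iff_maximalIdeal_eq.2 (by simpa using h)).isDomain
  | succ n ih =>
    obtain ⟨a, t, rfl⟩ := List.exists_cons_of_length_eq_add_one hn
    have hmem : ∀ b ∈ a :: t, b ∈ maximalIdeal R := fun b hb => h ▸ Ideal.subset_span hb
    -- Prime avoidance: `a + c` can replace `a` as a generator. A minimal prime containing `a + c`
    -- would contain all generators, so 𝔪 would have height 0 although the dimension is positive.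
    obtain ⟨c, hc, hcQ⟩ := exists_mem_ofList_forall_add_mem_imp
      (Ideal.finite_minimalPrimes_of_isNoetherianRing R ⊥) (fun Q hQ => hQ.1.1) a t
      (fun b hb => hmem b (List.mem_cons_of_mem _ hb))
    have hgen : maximalIdeal R = Ideal.ofList ([a + c] ++ t) := by
      rw [h, List.singleton_append, Ideal.ofList_cons, Ideal.ofList_cons]
      refine le_antisymm (sup_le ?_ le_sup_right) (sup_le ?_ le_sup_right)
      · rw [Ideal.span_singleton_le_iff_mem]
        rw [← Submodule.add_mem_iff_left _ (Ideal.mem_sup_right hc)]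
        exact Ideal.mem_sup_left (Ideal.mem_span_singleton_self _)
      · rw [Ideal.span_singleton_le_iff_mem]
        exact add_mem (Ideal.mem_sup_left (Ideal.mem_span_singleton_self _))
          (Ideal.mem_sup_right hc)
    obtain ⟨hloc, hmax, hdim⟩ := maximalIdeal_quotient_ofList hgen (d := n)
      (by rw [add_comm]; exact hd)
    have := ih (t.map _) hmax (by simpa using hn) hdim
    rw [Ideal.Quotient.isDomain_iff_prime, Ideal.ofList_singleton] at this
    refine isDomain_of_isPrime_span_singleton this fun Q hQ hx => ?_
    obtain ⟨h1, h2⟩ := hcQ Q hQ hx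
    have hle : maximalIdeal R ≤ Q := by
      rw [h]
      exact Ideal.span_le.2 fun b hb => (List.mem_cons.1 hb).elim (fun e => e ▸ h1) (h2 b)
    have hQp : Q.IsPrime := hQ.1.1
    obtain rfl := (maximalIdeal.isMaximal R).eq_of_le hQp.ne_top hle
    have h0 := Ideal.height_eq_zero_iff.2 hQ
    rw [← maximalIdeal_height_eq_ringKrullDim, h0] at hd
    have : ((n + 1 : ℕ) : ℕ∞) ≤ 0 := by exact_mod_cast hd
    simp at this

open IsLocalRing in
theorem isPrime_ofList_of_maximalIdeal_eq_append {R : Type*} [CommRing R] [IsLocalRing R]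
    [IsNoetherianRing R] {l₁ l₂ : List R} (h : maximalIdeal R = Ideal.ofList (l₁ ++ l₂))
    (hd : ((l₁.length + l₂.length : ℕ) : WithBot ℕ∞) ≤ ringKrullDim R) :
    (Ideal.ofList l₁).IsPrime := by
  obtain ⟨hloc, hmax, hdim⟩ := maximalIdeal_quotient_ofList h hd
  rw [← Ideal.Quotient.isDomain_iff_prime]
  exact isDomain_of_maximalIdeal_eq_ofList _ hmax (by simpa using hdim)

open IsLocalRing in
theorem ringKrullDim_le_length_of_maximalIdeal_eq_ofList {R : Type*} [CommRing R]
    [IsLocalRing R] [IsNoetherianRing R] {l : List R} (h : maximalIdeal R = Ideal.ofList l) :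
    ringKrullDim R ≤ l.length := by
  classical
  have hmin : maximalIdeal R ∈ (Ideal.span (l.toFinset : Set R)).minimalPrimes := by
    rw [List.coe_toFinset]
    change _ ∈ (Ideal.ofList l).minimalPrimes
    rw [← h, Ideal.minimalPrimes_eq_subsingleton_self]
    rfl
  have h1 := Ideal.height_le_card_of_mem_minimalPrimes_span_finset hmin
  rw [← maximalIdeal_height_eq_ringKrullDim]
  exact_mod_cast h1.trans (by exact_mod_cast l.toFinset_card_le)

/-! ### The filtration generated by I and d -/

/-- The filtration `J 0 = R`, `J 1 = I`, `J (n + 2) = I * J (n + 1) + d * J n`, generated by `I`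
in degree one and by `d` in degree two. -/
def degreeTwoFiltration {R : Type*} [CommRing R] (I : Ideal R) (d : R) : ℕ → Ideal R
  | 0 => ⊤
  | 1 => I
  | n + 2 => I * degreeTwoFiltration I d (n + 1) ⊔ Ideal.span {d} * degreeTwoFiltration I d n

section filtration

variable {R : Type*} [CommRing R] {I : Ideal R} {d : R}

theorem degreeTwoFiltration_add_two (n : ℕ) :
    degreeTwoFiltration I d (n + 2) = I * degreeTwoFiltration I d (n + 1) ⊔
        Ideal.span {d} * degreeTwoFiltration I d n := by
  rw [degreeTwoFiltration]

theorem ideal_mul_degreeTwoFiltration_le (n : ℕ) : I * degreeTwoFiltration I d n ≤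
    degreeTwoFiltration I d (n + 1) := by
  cases n with
  | zero => exact Ideal.mul_le_left (I := I) (J := ⊤)
  | succ n => rw [degreeTwoFiltration_add_two]; exact le_sup_left

theorem mul_mem_degreeTwoFiltration_succ {n : ℕ} {a b : R} (ha : a ∈ I) (hb :
    b ∈ degreeTwoFiltration I d n) :
    a * b ∈ degreeTwoFiltration I d (n + 1) :=
  ideal_mul_degreeTwoFiltration_le n (Ideal.mul_mem_mul ha hb)

theorem mul_mem_degreeTwoFiltration_add_two {n : ℕ} {b : R} (hb : b ∈ degreeTwoFiltration I d n) :
    d * b ∈ degreeTwoFiltration I d (n + 2) := by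
  rw [degreeTwoFiltration_add_two]
  exact Ideal.mem_sup_right (Ideal.mul_mem_mul (Ideal.mem_span_singleton_self d) hb)

theorem pow_mem_degreeTwoFiltration (m : ℕ) : d ^ m ∈ degreeTwoFiltration I d (2 * m) := by
  induction m with
  | zero => exact Submodule.mem_top
  | succ m ih => rw [pow_succ']; exact mul_mem_degreeTwoFiltration_add_two ih

theorem pow_le_degreeTwoFiltration (n : ℕ) : I ^ n ≤ degreeTwoFiltration I d n := by
  induction n with
  | zero => exact le_top
  | succ n ih =>
    rw [pow_succ']
    exact (Ideal.mul_mono_right ih).trans (ideal_mul_degreeTwoFiltration_le n)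

theorem degreeTwoFiltration_mul_pow_le {m : Ideal R} (hm : Ideal.span {d} * m ≤ I ^ 2) (n : ℕ) :
    degreeTwoFiltration I d n * m ^ (n / 2) ≤ I ^ n := by
  induction n using Nat.twoStepInduction with
  | zero => simp
  | one => simp [degreeTwoFiltration]
  | more n ih0 ih1 =>
    have hdiv : (n + 2) / 2 = n / 2 + 1 := by omega
    rw [degreeTwoFiltration_add_two, hdiv, Ideal.sup_mul]
    refine sup_le ?_ ?_
    · have hle : m ^ (n / 2 + 1) ≤ m ^ ((n + 1) / 2) := Ideal.pow_le_pow_right (by omega)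
      calc I * degreeTwoFiltration I d (n + 1) * m ^ (n / 2 + 1)
          ≤ I * (degreeTwoFiltration I d (n + 1) * m ^ ((n + 1) / 2)) := by
            rw [mul_assoc]; exact Ideal.mul_mono_right (Ideal.mul_mono_right hle)
        _ ≤ I * I ^ (n + 1) := Ideal.mul_mono_right ih1
        _ = I ^ (n + 2) := by ring
    · calc Ideal.span {d} * degreeTwoFiltration I d n * m ^ (n / 2 + 1)
          = (Ideal.span {d} * m) * (degreeTwoFiltration I d n * m ^ (n / 2)) := by ring
        _ ≤ I ^ 2 * I ^ n := Ideal.mul_mono hm ih0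
        _ = I ^ (n + 2) := by ring

end filtration

/-! ### Relations of the space curve and regularity of x modulo the filtration -/

/-- Generators `a, b, c` of an ideal and a further element `d` satisfying the relations of the
symbolic square of the ideal of the space curve `(t ^ 3, t ^ 4, t ^ 5)`. -/
structure SpaceCurveRelations {R : Type*} [CommRing R] (x y z a b c d : R) : Prop where
  linear_one : y * b = z * a + x * c
  linear_two : y * c = z * b - x ^ 2 * a
  x_mul : x * d = b ^ 2 - a * c
  y_mul : y * d = b * c + x * a ^ 2
  z_mul : z * d = c ^ 2 + x * a * b

namespace SpaceCurveRelations

variable {R : Type*} [CommRing R] {x y z a b c d : R}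

theorem fst_mem : a ∈ Ideal.span {a, b, c} := Ideal.subset_span (by simp)
theorem snd_mem : b ∈ Ideal.span {a, b, c} := Ideal.subset_span (by simp)
theorem trd_mem : c ∈ Ideal.span {a, b, c} := Ideal.subset_span (by simp)

theorem mul_maximal_le (h : SpaceCurveRelations x y z a b c d) :
    Ideal.span {d} * Ideal.span {x, y, z} ≤ Ideal.span {a, b, c} ^ 2 := by
  have ha : a ∈ Ideal.span {a, b, c} := fst_mem
  have hb : b ∈ Ideal.span {a, b, c} := snd_mem
  have hc : c ∈ Ideal.span {a, b, c} := trd_mem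
  rw [Ideal.span_singleton_mul_le_iff, pow_two]
  intro w hw
  obtain ⟨r, s, t, rfl⟩ := Submodule.mem_span_triple.1 hw
  have : d * (r • x + s • y + t • z) =
      r * (b * b - a * c) + s * (b * c + x * (a * a)) + t * (c * c + x * (a * b)) := by
    simp only [smul_eq_mul]
    linear_combination r * h.x_mul + s * h.y_mul + t * h.z_mul
  rw [this]
  have key {u v : R} (hu : u ∈ Ideal.span {a, b, c}) (hv : v ∈ Ideal.span {a, b, c}) :
      u * v ∈ Ideal.span {a, b, c} * Ideal.span {a, b, c} := Ideal.mul_mem_mul hu hv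
  exact add_mem (add_mem (Ideal.mul_mem_left _ _ (sub_mem (key hb hb) (key ha hc)))
    (Ideal.mul_mem_left _ _ (add_mem (key hb hc) (Ideal.mul_mem_left _ _ (key ha ha)))))
    (Ideal.mul_mem_left _ _ (add_mem (key hc hc) (Ideal.mul_mem_left _ _ (key ha hb))))

theorem _root_.Ideal.mem_span_singleton_mul_sup_sup {S : Type*} [CommRing S] {A B L : Ideal S}
    {a x w : S} : w ∈ Ideal.span {a} * A ⊔ L ⊔ Ideal.span {x} * B ↔
      ∃ u ∈ A, ∃ l ∈ L, ∃ v ∈ B, a * u + l + x * v = w := by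
  constructor
  · intro hw
    obtain ⟨p, hp, q, hq, rfl⟩ := Submodule.mem_sup.1 hw
    obtain ⟨r, hr, l, hl, rfl⟩ := Submodule.mem_sup.1 hp
    obtain ⟨u, hu, rfl⟩ := Ideal.mem_span_singleton_mul.1 hr
    obtain ⟨v, hv, rfl⟩ := Ideal.mem_span_singleton_mul.1 hq
    exact ⟨u, hu, l, hl, v, hv, rfl⟩
  · rintro ⟨u, hu, l, hl, v, hv, rfl⟩
    exact add_mem (Ideal.mem_sup_left (add_mem
      (Ideal.mem_sup_left (Ideal.mem_span_singleton_mul.2 ⟨u, hu, rfl⟩)) (Ideal.mem_sup_right hl)))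
      (Ideal.mem_sup_right (Ideal.mem_span_singleton_mul.2 ⟨v, hv, rfl⟩))

/-- `A` stands for the preceding term J (2m - 1); keeping it abstract lets m = 0, where there is no
such term, be treated with `A = ⊥`. -/
theorem mul_even_le {m : ℕ} {A : Ideal R} (hIA : Ideal.span {a, b, c} * A ≤
    degreeTwoFiltration (Ideal.span {a, b, c}) d (2 * m))
    (hE : degreeTwoFiltration (Ideal.span {a, b, c}) d (2 * m) ≤ Ideal.span {a} * A ⊔
        Ideal.span {d ^ m} ⊔
            Ideal.span {x} * degreeTwoFiltration (Ideal.span {a, b, c}) d (2 * m)) :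
    Ideal.span {a, b, c} * degreeTwoFiltration (Ideal.span {a, b, c}) d (2 * m) ≤
        Ideal.span {a} * degreeTwoFiltration (Ideal.span {a, b, c}) d (2 * m) ⊔
            Ideal.span {b * d ^ m, c * d ^ m} ⊔
      Ideal.span {x} * degreeTwoFiltration (Ideal.span {a, b, c}) d (2 * m + 1) := by
  refine Ideal.mul_le.2 fun r hr s hs => ?_
  obtain ⟨u, hu, l, hl, v, hv, rfl⟩ := Ideal.mem_span_singleton_mul_sup_sup.1 (hE hs)
  obtain ⟨t, rfl⟩ := Ideal.mem_span_singleton'.1 hl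
  obtain ⟨r₁, r₂, r₃, hr'⟩ := Submodule.mem_span_triple.1 hr
  simp only [smul_eq_mul] at hr'
  have hd : d ^ m ∈ degreeTwoFiltration (Ideal.span {a, b, c}) d
      (2 * m) := pow_mem_degreeTwoFiltration m
  refine Ideal.mem_span_singleton_mul_sup_sup.2
    ⟨r * u + r₁ * t * d ^ m, add_mem (hIA (Ideal.mul_mem_mul hr hu)) (Ideal.mul_mem_left _ _ hd),
      _, Ideal.mem_span_pair.2 ⟨r₂ * t, r₃ * t, rfl⟩,
      r * v, mul_mem_degreeTwoFiltration_succ hr hv, ?_⟩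
  linear_combination t * d ^ m * hr'

theorem d_mul_even_le {m : ℕ} {A : Ideal R} (hdA : Ideal.span {d} * A ≤
    degreeTwoFiltration (Ideal.span {a, b, c}) d (2 * m + 1))
    (hE : degreeTwoFiltration (Ideal.span {a, b, c}) d (2 * m) ≤ Ideal.span {a} * A ⊔
        Ideal.span {d ^ m} ⊔
            Ideal.span {x} * degreeTwoFiltration (Ideal.span {a, b, c}) d (2 * m)) :
    Ideal.span {d} * degreeTwoFiltration (Ideal.span {a, b, c}) d (2 * m) ≤
        Ideal.span {a} * degreeTwoFiltration (Ideal.span {a, b, c}) d (2 * m + 1) ⊔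
            Ideal.span {d ^ (m + 1)} ⊔
      Ideal.span {x} * degreeTwoFiltration (Ideal.span {a, b, c}) d (2 * m + 2) := by
  refine (Ideal.span_singleton_mul_le_iff).2 fun s hs => ?_
  obtain ⟨u, hu, l, hl, v, hv, rfl⟩ := Ideal.mem_span_singleton_mul_sup_sup.1 (hE hs)
  obtain ⟨t, rfl⟩ := Ideal.mem_span_singleton'.1 hl
  refine Ideal.mem_span_singleton_mul_sup_sup.2
    ⟨d * u, hdA (Ideal.mul_mem_mul (Ideal.mem_span_singleton_self d) hu),
      _, Ideal.mem_span_singleton'.2 ⟨t, rfl⟩,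
      d * v, mul_mem_degreeTwoFiltration_add_two hv, ?_⟩
  ring

/-- The products of b, c with b d^m, c d^m are reduced by the quadratic relations: b² = ac + xd, bc
= yd - xa², c² = zd - xab. -/
theorem mul_odd_le (h : SpaceCurveRelations x y z a b c d) {m : ℕ}
    (hO : degreeTwoFiltration (Ideal.span {a, b, c}) d (2 * m + 1) ≤
        Ideal.span {a} * degreeTwoFiltration (Ideal.span {a, b, c}) d (2 * m) ⊔
            Ideal.span {b * d ^ m, c * d ^ m} ⊔
      Ideal.span {x} * degreeTwoFiltration (Ideal.span {a, b, c}) d (2 * m + 1)) :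
    Ideal.span {a, b, c} * degreeTwoFiltration (Ideal.span {a, b, c}) d (2 * m + 1) ≤
        Ideal.span {a} * degreeTwoFiltration (Ideal.span {a, b, c}) d (2 * m + 1) ⊔
            Ideal.span {d ^ (m + 1)} ⊔
      Ideal.span {x} * degreeTwoFiltration (Ideal.span {a, b, c}) d (2 * m + 2) := by
  refine Ideal.mul_le.2 fun r hr s hs => ?_
  obtain ⟨u, hu, l, hl, v, hv, hs'⟩ := Ideal.mem_span_singleton_mul_sup_sup.1 (hO hs)
  obtain ⟨s₁, s₂, rfl⟩ := Ideal.mem_span_pair.1 hl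
  obtain ⟨r₁, r₂, r₃, hr'⟩ := Submodule.mem_span_triple.1 hr
  simp only [smul_eq_mul] at hr'
  have hd : d ^ m ∈ degreeTwoFiltration (Ideal.span {a, b, c}) d
      (2 * m) := pow_mem_degreeTwoFiltration m
  have hb : b * d ^ m ∈ degreeTwoFiltration (Ideal.span {a, b, c}) d
      (2 * m + 1) := mul_mem_degreeTwoFiltration_succ snd_mem hd
  have hc : c * d ^ m ∈ degreeTwoFiltration (Ideal.span {a, b, c}) d
      (2 * m + 1) := mul_mem_degreeTwoFiltration_succ trd_mem hd
  have ha : a * d ^ m ∈ degreeTwoFiltration (Ideal.span {a, b, c}) d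
      (2 * m + 1) := mul_mem_degreeTwoFiltration_succ fst_mem hd
  have haa : a * (a * d ^ m) ∈ degreeTwoFiltration (Ideal.span {a, b, c}) d
      (2 * m + 2) := mul_mem_degreeTwoFiltration_succ fst_mem ha
  have hab : a * (b * d ^ m) ∈ degreeTwoFiltration (Ideal.span {a, b, c}) d
      (2 * m + 2) := mul_mem_degreeTwoFiltration_succ fst_mem hb
  have hdd : d ^ (m + 1) ∈ degreeTwoFiltration (Ideal.span {a, b, c}) d
      (2 * m + 2) := pow_mem_degreeTwoFiltration (m + 1)
  refine Ideal.mem_span_singleton_mul_sup_sup.2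
    ⟨r * u + (r₁ * s₁) * (b * d ^ m) + (r₁ * s₂ + r₂ * s₁) * (c * d ^ m),
      add_mem (add_mem (mul_mem_degreeTwoFiltration_succ hr hu) (Ideal.mul_mem_left _ _ hb))
        (Ideal.mul_mem_left _ _ hc),
      _, Ideal.mem_span_singleton'.2 ⟨r₂ * s₂ * y + r₃ * s₁ * y + r₃ * s₂ * z, rfl⟩,
      r * v + r₂ * s₁ * d ^ (m + 1) - (r₂ * s₂ + r₃ * s₁) * (a * (a * d ^ m)) -
        (r₃ * s₂) * (a * (b * d ^ m)),
      sub_mem (sub_mem (add_mem (mul_mem_degreeTwoFiltration_succ hr hv)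
        (Ideal.mul_mem_left _ _ hdd)) (Ideal.mul_mem_left _ _ haa)) (Ideal.mul_mem_left _ _ hab),
      ?_⟩
  rw [← hs']
  linear_combination (s₁ * (b * d ^ m) + s₂ * (c * d ^ m)) * hr' +
    r₂ * s₁ * d ^ m * h.x_mul + (r₂ * s₂ + r₃ * s₁) * d ^ m * h.y_mul + r₃ * s₂ * d ^ m * h.z_mul

theorem d_mul_odd_le {m : ℕ}
    (hO : degreeTwoFiltration (Ideal.span {a, b, c}) d (2 * m + 1) ≤
        Ideal.span {a} * degreeTwoFiltration (Ideal.span {a, b, c}) d (2 * m) ⊔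
            Ideal.span {b * d ^ m, c * d ^ m} ⊔
      Ideal.span {x} * degreeTwoFiltration (Ideal.span {a, b, c}) d (2 * m + 1)) :
    Ideal.span {d} * degreeTwoFiltration (Ideal.span {a, b, c}) d (2 * m + 1) ≤
        Ideal.span {a} * degreeTwoFiltration (Ideal.span {a, b, c}) d (2 * (m + 1)) ⊔
      Ideal.span {b * d ^ (m + 1), c * d ^ (m + 1)} ⊔
          Ideal.span {x} * degreeTwoFiltration (Ideal.span {a, b, c}) d (2 * (m + 1) + 1) := by
  refine (Ideal.span_singleton_mul_le_iff).2 fun s hs => ?_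
  obtain ⟨u, hu, l, hl, v, hv, rfl⟩ := Ideal.mem_span_singleton_mul_sup_sup.1 (hO hs)
  obtain ⟨s₁, s₂, rfl⟩ := Ideal.mem_span_pair.1 hl
  refine Ideal.mem_span_singleton_mul_sup_sup.2
    ⟨d * u, mul_mem_degreeTwoFiltration_add_two hu, _, Ideal.mem_span_pair.2 ⟨s₁, s₂, rfl⟩,
      d * v, mul_mem_degreeTwoFiltration_add_two hv, ?_⟩
  ring

/-- Modulo `x` times its `n`-th term `J n`, the term `J n` of the filtration is generated by
`a * J (n - 1)` together with `d ^ m` if `n = 2 * m`, and with `b * d ^ m` and `c * d ^ m` if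
`n = 2 * m + 1`. -/
theorem degreeTwoFiltration_le (h : SpaceCurveRelations x y z a b c d) (m : ℕ) :
    degreeTwoFiltration (Ideal.span {a, b, c}) d (2 * m + 1) ≤
        Ideal.span {a} * degreeTwoFiltration (Ideal.span {a, b, c}) d (2 * m) ⊔
            Ideal.span {b * d ^ m, c * d ^ m} ⊔
        Ideal.span {x} * degreeTwoFiltration (Ideal.span {a, b, c}) d (2 * m + 1) ∧
      degreeTwoFiltration (Ideal.span {a, b, c}) d (2 * m + 2) ≤
          Ideal.span {a} * degreeTwoFiltration (Ideal.span {a, b, c}) d (2 * m + 1) ⊔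
              Ideal.span {d ^ (m + 1)} ⊔
        Ideal.span {x} * degreeTwoFiltration (Ideal.span {a, b, c}) d (2 * m + 2) := by
  induction m with
  | zero =>
    have hE : degreeTwoFiltration (Ideal.span {a, b, c}) d (2 * 0) ≤ Ideal.span {a} * ⊥ ⊔
        Ideal.span {d ^ 0} ⊔
            Ideal.span {x} * degreeTwoFiltration (Ideal.span {a, b, c}) d (2 * 0) := by
      simp
    have hO := mul_even_le (x := x) (a := a) (b := b) (c := c) (m := 0) (A := ⊥) (by simp) hE
    have hO' : degreeTwoFiltration (Ideal.span {a, b, c}) d (2 * 0 + 1) ≤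
        Ideal.span {a} * degreeTwoFiltration (Ideal.span {a, b, c}) d (2 * 0) ⊔
        Ideal.span {b * d ^ 0, c * d ^ 0} ⊔
            Ideal.span {x} * degreeTwoFiltration (Ideal.span {a, b, c}) d (2 * 0 + 1) := by
      refine le_trans ?_ hO
      simp [degreeTwoFiltration]
    refine ⟨hO', ?_⟩
    rw [degreeTwoFiltration_add_two]
    refine (sup_le (h.mul_odd_le hO') (d_mul_even_le (A := ⊥) (by simp) hE)).trans ?_
    rw [degreeTwoFiltration_add_two]
  | succ m ih =>
    have hO : degreeTwoFiltration (Ideal.span {a, b, c}) d (2 * (m + 1) + 1) ≤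
        Ideal.span {a} * degreeTwoFiltration (Ideal.span {a, b, c}) d (2 * (m + 1)) ⊔
        Ideal.span {b * d ^ (m + 1), c * d ^ (m + 1)} ⊔
          Ideal.span {x} * degreeTwoFiltration (Ideal.span {a, b, c}) d (2 * (m + 1) + 1) :=
      (degreeTwoFiltration_add_two (2 * m + 1)).trans_le <| sup_le
        (mul_even_le (m := m + 1) (ideal_mul_degreeTwoFiltration_le _) ih.2) (d_mul_odd_le ih.1)
    exact ⟨hO, (degreeTwoFiltration_add_two (2 * (m + 1))).trans_le <| sup_le (h.mul_odd_le hO)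
      (d_mul_even_le (m := m + 1) (Ideal.span_singleton_mul_le_iff.2
        fun s hs => mul_mem_degreeTwoFiltration_add_two hs) ih.2)⟩

/-- Modulo x the generators are the monomials y², yz, z², z³. Divisibility of w by x forces the
coefficients of the generators outside a J (n - 1) into (x, y); the relations for y b, y c, y d then
rewrite w as a u + x v with u in J (n - 1) and v in J n. Since x does not divide a, it divides u,
and induction on n applies. -/
theorem exists_mem_degreeTwoFiltration_of_dvd (h : SpaceCurveRelations x y z a b c d)
    (hx : Prime x) (hxy : (Ideal.span {x, y}).IsPrime) (hz : z ∉ Ideal.span {x, y})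
    (hy : ¬ x ∣ y) (ha : x ∣ a - y ^ 2) (hb : x ∣ b - y * z) (hc : x ∣ c - z ^ 2)
    (hd : x ∣ d - z ^ 3) (n : ℕ) {w : R} (hw :
        w ∈ degreeTwoFiltration (Ideal.span {a, b, c}) d n) (hxw : x ∣ w) :
    ∃ u ∈ degreeTwoFiltration (Ideal.span {a, b, c}) d n, w = x * u := by
  obtain ⟨a', ha⟩ := ha
  obtain ⟨b', hb⟩ := hb
  obtain ⟨c', hc⟩ := hc
  obtain ⟨d', hd⟩ := hd
  have hxP : x ∈ Ideal.span {x, y} := Ideal.subset_span (by simp)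
  have hyP : y ∈ Ideal.span {x, y} := Ideal.subset_span (by simp)
  have hcP : c ∉ Ideal.span {x, y} := fun hm => hz <| hxy.mem_of_pow_mem 2 <| by
    have : z ^ 2 = c - c' * x := by linear_combination -hc
    rw [this]
    exact sub_mem hm (Ideal.mul_mem_left _ _ hxP)
  have hdP : d ∉ Ideal.span {x, y} := fun hm => hz <| hxy.mem_of_pow_mem 3 <| by
    have : z ^ 3 = d - d' * x := by linear_combination -hd
    rw [this]
    exact sub_mem hm (Ideal.mul_mem_left _ _ hxP)
  have hdm (m : ℕ) : d ^ m ∉ Ideal.span {x, y} := fun hm => hdP (hxy.mem_of_pow_mem m hm)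
  have hxa : ¬ x ∣ a := fun ⟨e, he⟩ =>
    hy (hx.dvd_of_dvd_pow (n := 2) ⟨e - a', by linear_combination he - ha⟩)
  have key {r s : R} (hs : s ∉ Ideal.span {x, y}) (hrs : r * s ∈ Ideal.span {x, y}) :
      ∃ α β, r = α * x + β * y := by
    obtain ⟨α, β, hr⟩ := Ideal.mem_span_pair.1 ((hxy.mem_or_mem hrs).resolve_right hs)
    exact ⟨α, β, hr.symm⟩
  have mul_notMem {r s : R} (hr : r ∉ Ideal.span {x, y}) (hs : s ∉ Ideal.span {x, y}) :
      r * s ∉ Ideal.span {x, y} := fun hm => (hxy.mem_or_mem hm).elim hr hs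
  induction n using Nat.strong_induction_on generalizing w with
  | _ n ih =>
  have finish {k : ℕ} (hk : k < n) (hkn : n = k + 1) {u v : R} (hu :
      u ∈ degreeTwoFiltration (Ideal.span {a, b, c}) d k) (hv :
          v ∈ degreeTwoFiltration (Ideal.span {a, b, c}) d n)
      (hwuv : w = a * u + x * v) :
          ∃ u ∈ degreeTwoFiltration (Ideal.span {a, b, c}) d n, w = x * u := by
    subst hkn
    have hdvd : x ∣ u := (hx.dvd_or_dvd (show x ∣ a * u by
      rw [show a * u = w - x * v by rw [hwuv]; ring]
      exact dvd_sub hxw (dvd_mul_right _ _))).resolve_left hxa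
    obtain ⟨u', hu', rfl⟩ := ih k hk hu hdvd
    exact ⟨a * u' + v, add_mem (mul_mem_degreeTwoFiltration_succ fst_mem hu') hv, by
      rw [hwuv]; ring⟩
  obtain ⟨e, he⟩ := hxw
  rcases Nat.even_or_odd' n with ⟨m, rfl | rfl⟩
  · cases m with
    | zero => exact ⟨e, Submodule.mem_top, he⟩
    | succ m =>
      obtain ⟨u, hu, l, hl, v, hv, hs⟩ :=
        Ideal.mem_span_singleton_mul_sup_sup.1 ((h.degreeTwoFiltration_le m).2 hw)
      obtain ⟨r, rfl⟩ := Ideal.mem_span_singleton'.1 hl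
      -- Modulo (x, y) only `r * d ^ (m + 1)` survives, and d is not in this prime.
      obtain ⟨α, β, rfl⟩ := key (r := r) (hdm (m + 1)) (Ideal.mem_span_pair.2
        ⟨e - v - a' * u, - y * u, by linear_combination -he - hs + u * ha⟩)
      -- Replace y d by bc + xa²; modulo x, a ≡ y² and b ≡ yz, so a factor y cancels. This puts β in
      -- (x, y) as well, and y b = z a + x c then absorbs the remaining term.
      have hdvd : x ∣ y * u + β * z * c * d ^ m := by
        refine (hx.dvd_or_dvd (a := y) ⟨e - v - a' * u - α * d ^ (m + 1) - β * a ^ 2 * d ^ m -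
          β * b' * c * d ^ m, ?_⟩).resolve_left hy
        linear_combination he + hs - u * ha - β * d ^ m * h.y_mul - β * c * d ^ m * hb
      obtain ⟨f, hf⟩ := hdvd
      obtain ⟨α', β', rfl⟩ := key (r := β) (s := z * c * d ^ m)
        (mul_notMem (mul_notMem hz hcP) (hdm m))
        (Ideal.mem_span_pair.2 ⟨f, - u, by linear_combination -hf⟩)
      have hD : d ^ m ∈ degreeTwoFiltration (Ideal.span {a, b, c}) d
          (2 * m) := pow_mem_degreeTwoFiltration m
      have hC : c * d ^ m ∈ degreeTwoFiltration (Ideal.span {a, b, c}) d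
          (2 * m + 1) := mul_mem_degreeTwoFiltration_succ trd_mem hD
      have hA : a * d ^ m ∈ degreeTwoFiltration (Ideal.span {a, b, c}) d
          (2 * m + 1) := mul_mem_degreeTwoFiltration_succ fst_mem hD
      refine finish (k := 2 * m + 1) (by omega) rfl
        (u := u + β' * z * (c * d ^ m))
        (v := v + α * d ^ (m + 1) + (α' * x + β' * y) * (a * (a * d ^ m)) +
          α' * (b * (c * d ^ m)) + β' * (c * (c * d ^ m)))
        (add_mem hu (Ideal.mul_mem_left _ _ hC)) ?_ ?_
      · exact add_mem (add_mem (add_mem (add_mem hv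
          (Ideal.mul_mem_left _ _ (pow_mem_degreeTwoFiltration (m + 1))))
          (Ideal.mul_mem_left _ _ (mul_mem_degreeTwoFiltration_succ fst_mem hA)))
          (Ideal.mul_mem_left _ _ (mul_mem_degreeTwoFiltration_succ snd_mem hC)))
          (Ideal.mul_mem_left _ _ (mul_mem_degreeTwoFiltration_succ trd_mem hC))
      · linear_combination -hs + (α' * x + β' * y) * d ^ m * h.y_mul +
          β' * c * d ^ m * h.linear_one
  · obtain ⟨u, hu, l, hl, v, hv, hs⟩ :=
      Ideal.mem_span_singleton_mul_sup_sup.1 ((h.degreeTwoFiltration_le m).1 hw)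
    obtain ⟨c₁, c₂, rfl⟩ := Ideal.mem_span_pair.1 hl
    -- Modulo (x, y) only the term in c survives. Using y c = z b - x²a, the y-part of `c₂` moves to
    -- b, whose coefficient becomes `c₁ + z * β`.
    obtain ⟨α, β, rfl⟩ := key (r := c₂) (s := c * d ^ m) (mul_notMem hcP (hdm m))
      (Ideal.mem_span_pair.2 ⟨e - v - a' * u - c₁ * b' * d ^ m, - y * u - c₁ * z * d ^ m, by
        linear_combination -he - hs + u * ha + c₁ * d ^ m * hb⟩)
    have hdvd : x ∣ y * u + (c₁ + z * β) * z * d ^ m := by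
      refine (hx.dvd_or_dvd (a := y) ⟨e - v - a' * u - α * c * d ^ m + β * x * a * d ^ m -
        (c₁ + z * β) * b' * d ^ m, ?_⟩).resolve_left hy
      linear_combination he + hs - u * ha - β * d ^ m * h.linear_two -
        (c₁ + z * β) * d ^ m * hb
    obtain ⟨f, hf⟩ := hdvd
    -- The combined coefficient of b also lies in (x, y), so y b = z a + x c applies.
    obtain ⟨α', β', hαβ⟩ := key (r := c₁ + z * β) (s := z * d ^ m) (mul_notMem hz (hdm m))
      (Ideal.mem_span_pair.2 ⟨f, - u, by linear_combination -hf⟩)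
    have hD : d ^ m ∈ degreeTwoFiltration (Ideal.span {a, b, c}) d
        (2 * m) := pow_mem_degreeTwoFiltration m
    refine finish (k := 2 * m) (by omega) rfl
      (u := u + β' * z * d ^ m)
      (v := v + α * (c * d ^ m) - β * x * (a * d ^ m) + α' * (b * d ^ m) + β' * (c * d ^ m))
      (add_mem hu (Ideal.mul_mem_left _ _ hD)) ?_ ?_
    · exact add_mem (add_mem (sub_mem (add_mem hv
        (Ideal.mul_mem_left _ _ (mul_mem_degreeTwoFiltration_succ trd_mem hD)))
        (Ideal.mul_mem_left _ _ (mul_mem_degreeTwoFiltration_succ fst_mem hD)))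
        (Ideal.mul_mem_left _ _ (mul_mem_degreeTwoFiltration_succ snd_mem hD)))
        (Ideal.mul_mem_left _ _ (mul_mem_degreeTwoFiltration_succ trd_mem hD))
    · linear_combination -hs + β * d ^ m * h.linear_two + b * d ^ m * hαβ +
        β' * d ^ m * h.linear_one

end SpaceCurveRelations

/-! ### The ideal of minors -/

theorem minorsIdeal_two_of_two_by_three {R : Type*} [CommRing R]
    (A : Matrix (Fin 2) (Fin 3) R) :
    minorsIdeal 2 A = Ideal.span {A 0 0 * A 1 1 - A 0 1 * A 1 0,
      A 0 0 * A 1 2 - A 0 2 * A 1 0, A 0 1 * A 1 2 - A 0 2 * A 1 1} := by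
  have hmem (i j : Fin 3) (hij : i < j) : A 0 i * A 1 j - A 0 j * A 1 i ∈ minorsIdeal 2 A := by
    refine Ideal.subset_span ⟨RelEmbedding.refl _,
      OrderEmbedding.ofStrictMono ![i, j] (by simpa [Fin.strictMono_iff_lt_succ] using hij), ?_⟩
    simp [Matrix.det_fin_two]
  refine le_antisymm (Ideal.span_le.2 ?_) (Ideal.span_le.2 ?_)
  · rintro _ ⟨r, c, rfl⟩
    have hr : r 0 < r 1 := r.strictMono (by decide)
    have hc : c 0 < c 1 := c.strictMono (by decide)
    rw [Matrix.det_fin_two]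
    simp only [Matrix.submatrix_apply]
    obtain ⟨hr0, hr1⟩ : r 0 = 0 ∧ r 1 = 1 := by omega
    rw [hr0, hr1]
    obtain ⟨h0, h1⟩ | ⟨h0, h1⟩ | ⟨h0, h1⟩ :
        (c 0 = 0 ∧ c 1 = 1) ∨ (c 0 = 0 ∧ c 1 = 2) ∨ (c 0 = 1 ∧ c 1 = 2) := by omega
    all_goals rw [h0, h1]; exact Ideal.subset_span (by simp)
  · rintro _ (rfl | rfl | rfl)
    exacts [hmem 0 1 (by decide), hmem 0 2 (by decide), hmem 1 2 (by decide)]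

theorem minorsIdeal_spaceCurve {R : Type*} [CommRing R] (x y z : R) :
    minorsIdeal 2 !![x, y, z; y, z, x ^ 2] =
      Ideal.span {y ^ 2 - x * z, y * z - x ^ 3, z ^ 2 - x ^ 2 * y} := by
  rw [minorsIdeal_two_of_two_by_three]
  simp only [Matrix.of_apply, Matrix.cons_val', Matrix.cons_val_zero, Matrix.cons_val_one,
    Matrix.cons_val]
  refine le_antisymm (Ideal.span_le.2 ?_) (Ideal.span_le.2 ?_)
  · rintro _ (rfl | rfl | rfl) <;> rw [SetLike.mem_coe, ← neg_mem_iff] <;>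
      refine Ideal.subset_span ?_
    · exact Or.inl (by ring)
    · exact Or.inr (Or.inl (by ring))
    · exact Or.inr (Or.inr (show _ = _ by ring))
  · rintro _ (rfl | rfl | rfl) <;> rw [SetLike.mem_coe, ← neg_mem_iff] <;>
      refine Ideal.subset_span ?_
    · exact Or.inl (by ring)
    · exact Or.inr (Or.inl (by ring))
    · exact Or.inr (Or.inr (show _ = _ by ring))

theorem spaceCurveRelations {R : Type*} [CommRing R] (x y z : R) :
    SpaceCurveRelations x y z (y ^ 2 - x * z) (y * z - x ^ 3) (z ^ 2 - x ^ 2 * y)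
      (z ^ 3 + x ^ 5 - 3 * x ^ 2 * y * z + x * y ^ 3) where
  linear_one := by ring
  linear_two := by ring
  x_mul := by ring
  y_mul := by ring
  z_mul := by ring

/-! ### Primes over I, symbolic powers and depth -/

theorem SpaceCurveRelations.mem_of_isPrime {R : Type*} [CommRing R] {x y z a b c d : R}
    (h : SpaceCurveRelations x y z a b c d) {p : Ideal R} (hp : p.IsPrime) (ha : a ∈ p)
    (hd : d ∈ p) : Ideal.span {a, b, c} ≤ p := by
  have hb : b ∈ p := hp.mem_of_pow_mem 2 <| by
    rw [show b ^ 2 = x * d + c * a by linear_combination -h.x_mul]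
    exact add_mem (p.mul_mem_left _ hd) (p.mul_mem_left _ ha)
  have hc : c ∈ p := hp.mem_of_pow_mem 2 <| by
    rw [show c ^ 2 = z * d - (x * a) * b by linear_combination -h.z_mul]
    exact sub_mem (p.mul_mem_left _ hd) (p.mul_mem_left _ hb)
  refine Ideal.span_le.2 ?_
  rintro _ (rfl | rfl | rfl) <;> assumption

-- By the relations for b² and c², V(a, d) ⊆ V(I). If 𝔪 were minimal over I it would be minimal over
-- (a, d), and Krull's height theorem would bound the dimension by 2.
open IsLocalRing in
theorem SpaceCurveRelations.maximalIdeal_notMem_minimalPrimes {R : Type*} [CommRing R]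
    [IsLocalRing R] [IsNoetherianRing R] (hdim : 2 < ringKrullDim R) {x y z a b c d : R}
    (h : SpaceCurveRelations x y z a b c d) (hd : d ∈ maximalIdeal R) :
    maximalIdeal R ∉ (Ideal.span {a, b, c}).minimalPrimes := by
  classical
  intro hm
  have hmin : maximalIdeal R ∈ (Ideal.span (({a, d} : Finset R) : Set R)).minimalPrimes := by
    refine ⟨⟨hm.1.1, Ideal.span_le.2 ?_⟩, fun p hp hle => hm.2 ⟨hp.1, ?_⟩ hle⟩
    · intro r hr
      simp only [Finset.coe_insert, Finset.coe_singleton, Set.mem_insert_iff,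
        Set.mem_singleton_iff] at hr
      rcases hr with rfl | rfl
      · exact hm.1.2 (Ideal.subset_span (by simp))
      · exact hd
    · exact h.mem_of_isPrime hp.1 (hp.2 (Ideal.subset_span (by simp)))
        (hp.2 (Ideal.subset_span (by simp)))
  have h1 := (Ideal.height_le_card_of_mem_minimalPrimes_span_finset hmin).trans
    (Nat.cast_le.2 Finset.card_le_two)
  rw [← maximalIdeal_height_eq_ringKrullDim] at hdim
  exact not_lt.2 h1 (WithBot.coe_lt_coe.1 hdim)

theorem mem_symbolicPower_iff {R : Type*} [CommRing R] {I : Ideal R} {n : ℕ} {s : R} :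
    s ∈ symbolicPower I n ↔ ∀ p ∈ I.minimalPrimes, ∃ u ∉ p, u * s ∈ I ^ n := by
  simp only [symbolicPower, Ideal.mem_iInf, Ideal.mem_comap]
  constructor
  · intro h p hp
    have := hp.1.1
    obtain ⟨u, hu, hus⟩ := (IsLocalization.algebraMap_mem_map_algebraMap_iff p.primeCompl
      (Localization.AtPrime p) (I ^ n) s).1 (h ⟨p, hp.1.1⟩ hp)
    exact ⟨u, hu, hus⟩
  · intro h p hp
    obtain ⟨u, hu, hus⟩ := h p.asIdeal hp
    exact (IsLocalization.algebraMap_mem_map_algebraMap_iff p.asIdeal.primeCompl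
      (Localization.AtPrime p.asIdeal) (I ^ n) s).2 ⟨u, hu, hus⟩

open IsLocalRing in
/-- If the closed point is the only point of `V(I)` on which `x` vanishes, then a prime strictly
containing a minimal prime of `I` is maximal. -/
theorem eq_maximalIdeal_of_minimalPrimes_lt {R : Type*} [CommRing R] [IsLocalRing R]
    [IsNoetherianRing R] {I : Ideal R} {x : R} (hx : x ∈ maximalIdeal R)
    (hI : ∀ p : Ideal R, p.IsPrime → I ≤ p → x ∈ p → p = maximalIdeal R)
    {p P : Ideal R} (hp : p ∈ I.minimalPrimes) (hP : P.IsPrime) (hlt : p < P) :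
    P = maximalIdeal R := by
  by_contra hne
  have hPm : P < maximalIdeal R := lt_of_le_of_ne (le_maximalIdeal hP.ne_top) hne
  have hpp : p.IsPrime := hp.1.1
  have hmin : maximalIdeal R ∈ (p ⊔ Ideal.span {x}).minimalPrimes := by
    refine ⟨⟨inferInstance, sup_le (hlt.trans hPm).le
      ((Ideal.span_singleton_le_iff_mem _).2 hx)⟩, fun Q hQ _ => ?_⟩
    exact (hI Q hQ.1 (hp.1.2.trans (le_sup_left.trans hQ.2))
      (hQ.2 (Ideal.mem_sup_right (Ideal.mem_span_singleton_self x)))).ge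
  -- In R/p the maximal ideal is minimal over the image of x, hence of height at most 1, which
  -- excludes a chain p < P < 𝔪.
  have hht := Ideal.map_height_le_one_of_mem_minimalPrimes hmin
  have hmp {Q : Ideal R} (hQ : Q.IsPrime) (hle : p ≤ Q) :
      (Q.map (Ideal.Quotient.mk p)).IsPrime :=
    Ideal.map_isPrime_of_surjective Ideal.Quotient.mk_surjective (by rwa [Ideal.mk_ker])
  have hcm {Q : Ideal R} (hle : p ≤ Q) :
      (Q.map (Ideal.Quotient.mk p)).comap (Ideal.Quotient.mk p) = Q := by
    rw [Ideal.comap_map_of_surjective _ Ideal.Quotient.mk_surjective, ← RingHom.ker_eq_comap_bot,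
      Ideal.mk_ker, sup_eq_left.2 hle]
  have hmap {Q Q' : Ideal R} (hQ : p ≤ Q) (hQ' : Q < Q') :
      Q.map (Ideal.Quotient.mk p) < Q'.map (Ideal.Quotient.mk p) := by
    refine lt_of_le_of_ne (Ideal.map_mono hQ'.le) fun e => hQ'.ne ?_
    rw [← hcm hQ, ← hcm (hQ.trans hQ'.le), e]
  have := hmp (Q := maximalIdeal R) inferInstance (hlt.trans hPm).le
  have := hmp hP hlt.le
  have := hmp hpp le_rfl
  have h0 := (Ideal.height_le_iff (n := 1)).1 (by exact_mod_cast hht) _ ‹_› (hmap hlt.le hPm)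
  rw [Nat.cast_one, Order.lt_one_iff, Ideal.height_eq_zero_iff] at h0
  exact (hmap le_rfl hlt).not_ge (h0.2 ⟨‹_›, bot_le⟩ (hmap le_rfl hlt).le)

open IsLocalRing in
/-- Let the closed point be the only point of `V(I)` on which `x` vanishes. If `x` is a nonzero
divisor modulo an ideal containing `I ^ n`, then this ideal contains `I⁽ⁿ⁾`. -/
theorem symbolicPower_le {R : Type*} [CommRing R] [IsLocalRing R]
    [IsNoetherianRing R] {I K : Ideal R} {x : R} (hx : x ∈ maximalIdeal R)
    (hI : ∀ p : Ideal R, p.IsPrime → I ≤ p → x ∈ p → p = maximalIdeal R)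
    {n : ℕ} (hK : I ^ n ≤ K) (hxK : ∀ w, x * w ∈ K → w ∈ K) : symbolicPower I n ≤ K := by
  intro s hs
  rw [mem_symbolicPower_iff] at hs
  -- A prime containing Iⁿ : s contains I but is not minimal over it, so it is 𝔪 and contains x.
  have hrad : x ∈ ((I ^ n).colon {s}).radical := by
    rw [Ideal.radical_eq_sInf, Ideal.mem_sInf]
    rintro P ⟨hle, hP⟩
    have hIP : I ≤ P := hP.le_of_pow_le (n := n) fun r hr => hle <| by
      rw [Submodule.mem_colon_singleton, smul_eq_mul]
      exact Ideal.mul_mem_right _ _ hr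
    obtain ⟨p, hp, hpP⟩ := Ideal.exists_minimalPrimes_le hIP
    obtain ⟨u, hu, hus⟩ := hs p hp
    have huP : u ∈ P := hle (by rwa [Submodule.mem_colon_singleton, smul_eq_mul])
    rw [eq_maximalIdeal_of_minimalPrimes_lt hx hI hp hP
      (lt_of_le_of_ne hpP fun e => hu (e ▸ huP))]
    exact hx
  obtain ⟨k, hk⟩ := hrad
  rw [Submodule.mem_colon_singleton, smul_eq_mul] at hk
  replace hk := hK hk
  induction k with
  | zero => simpa using hk
  | succ k ih => exact ih (hxK _ (by rwa [pow_succ', mul_assoc] at hk))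

open IsLocalRing in
theorem localDepth_pos_of_isSMulRegular {R : Type*} [CommRing R] [IsLocalRing R] {M : Type*}
    [AddCommGroup M] [Module R M] {x : R} (hx : x ∈ maximalIdeal R) (hreg : IsSMulRegular M x) :
    0 < localDepth R M := by
  unfold localDepth
  split_ifs with h
  · exact ENat.top_pos
  · refine lt_of_lt_of_le (b := ((1 : ℕ) : ℕ∞)) (by simp) ?_
    refine le_iSup₂_of_le [x] ⟨⟨(RingTheory.Sequence.isWeaklyRegular_singleton_iff M x).2 hreg,
      fun htop => h (top_le_iff.1 ?_)⟩, by simpa using hx⟩ (by simp)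
    refine htop.le.trans (Submodule.smul_mono_left ?_)
    rw [Ideal.ofList_singleton, Ideal.span_singleton_le_iff_mem]
    exact hx

theorem theorem5p9 {R : Type*} [CommRing R] [IsRegularLocalRing R]
    (hdim : ringKrullDim R = 3) (x y z : R)
    (hxyz : IsLocalRing.maximalIdeal R = Ideal.span {x, y, z})
    (I : Ideal R) (hI : I = minorsIdeal 2 !![x, y, z; y, z, x ^ 2])
    (n : ℕ) (hn : 1 ≤ n) (q : ℕ) (hq : q = n / 2) :
    0 < localDepth R (R ⧸ (I ^ n).colon ((IsLocalRing.maximalIdeal R ^ q : Ideal R) : Set R)) ∧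
      symbolicPower I n =
        (I ^ n).colon ((IsLocalRing.maximalIdeal R ^ q : Ideal R) : Set R) := by
  subst hq
  rw [minorsIdeal_spaceCurve] at hI
  have hrel := spaceCurveRelations x y z
  have hx : x ∈ IsLocalRing.maximalIdeal R := hxyz ▸ Ideal.subset_span (by simp)
  have hy : y ∈ IsLocalRing.maximalIdeal R := hxyz ▸ Ideal.subset_span (by simp)
  have hz : z ∈ IsLocalRing.maximalIdeal R := hxyz ▸ Ideal.subset_span (by simp)
  have hlist : IsLocalRing.maximalIdeal R = Ideal.ofList [x, y, z] := by
    rw [hxyz]; congr 1; ext; simp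
  have hdomain : IsDomain R :=
    isDomain_of_maximalIdeal_eq_ofList _ hlist (by rw [hdim]; rfl)
  have hxy : (Ideal.span {x, y}).IsPrime := by
    have := isPrime_ofList_of_maximalIdeal_eq_append (l₁ := [x, y]) (l₂ := [z]) hlist
      (by rw [hdim]; rfl)
    rwa [Ideal.ofList_cons, Ideal.ofList_singleton, ← Ideal.span_insert] at this
  have hxp : (Ideal.span {x}).IsPrime := by
    have := isPrime_ofList_of_maximalIdeal_eq_append (l₁ := [x]) (l₂ := [y, z]) hlist
      (by rw [hdim]; rfl)
    rwa [Ideal.ofList_singleton] at this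
  have hshort (u v : R) : IsLocalRing.maximalIdeal R ≠ Ideal.span {u, v} := fun h => by
    have := ringKrullDim_le_length_of_maximalIdeal_eq_ofList (l := [u, v])
      (by rw [h, Ideal.ofList_cons, Ideal.ofList_singleton, Ideal.span_insert])
    rw [hdim] at this
    exact absurd this (show ¬ (3 : WithBot ℕ∞) ≤ ((2 : ℕ) : WithBot ℕ∞) by decide)
  have hzxy : z ∉ Ideal.span {x, y} := fun h => hshort x y <| by
    rw [hxyz]
    refine le_antisymm (Ideal.span_le.2 ?_) (Ideal.span_mono (by simp [Set.insert_subset_iff]))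
    rintro _ (rfl | rfl | rfl)
    exacts [Ideal.subset_span (by simp), Ideal.subset_span (by simp), h]
  have hyx : ¬ x ∣ y := fun h => hshort x z <| by
    rw [hxyz]
    refine le_antisymm (Ideal.span_le.2 ?_) (Ideal.span_mono (by simp [Set.insert_subset_iff]))
    rintro _ (rfl | rfl | rfl)
    exacts [Ideal.subset_span (by simp), Ideal.mem_of_dvd _ h (Ideal.subset_span (by simp)),
      Ideal.subset_span (by simp)]
  have hx0 : x ≠ 0 := fun h => hshort y z (by rw [hxyz, h, Ideal.span_insert_zero])
  have hxprime : Prime x := (Ideal.span_singleton_prime hx0).1 hxp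
  have hV (p : Ideal R) (hp : p.IsPrime) (hIp : I ≤ p) (hxp : x ∈ p) :
      p = IsLocalRing.maximalIdeal R := by
    refine ((IsLocalRing.maximalIdeal.isMaximal R).eq_of_le hp.ne_top ?_).symm
    subst hI
    have hyp : y ∈ p := hp.mem_of_pow_mem 2 <| by
      rw [show y ^ 2 = (y ^ 2 - x * z) + z * x by ring]
      exact add_mem (hIp (Ideal.subset_span (by simp))) (p.mul_mem_left _ hxp)
    have hzp : z ∈ p := hp.mem_of_pow_mem 2 <| by
      rw [show z ^ 2 = (z ^ 2 - x ^ 2 * y) + x ^ 2 * y by ring]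
      exact add_mem (hIp (Ideal.subset_span (by simp))) (p.mul_mem_left _ hyp)
    rw [hxyz]
    refine Ideal.span_le.2 ?_
    rintro _ (rfl | rfl | rfl) <;> assumption
  set d := z ^ 3 + x ^ 5 - 3 * x ^ 2 * y * z + x * y ^ 3 with hd
  have hdm : d ∈ IsLocalRing.maximalIdeal R := by
    rw [show d = z ^ 2 * z + (x ^ 4 - 3 * x * y * z + y ^ 3) * x by rw [hd]; ring]
    exact add_mem (Ideal.mul_mem_left _ _ hz) (Ideal.mul_mem_left _ _ hx)
  have hmI : IsLocalRing.maximalIdeal R ∉ I.minimalPrimes := by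
    rw [hI]
    exact hrel.maximalIdeal_notMem_minimalPrimes (by rw [hdim]; decide) hdm
  have hnzd (w : R) (hw : x * w ∈ degreeTwoFiltration I d n) : w ∈ degreeTwoFiltration I d n := by
    subst hI
    obtain ⟨u, hu, huw⟩ := hrel.exists_mem_degreeTwoFiltration_of_dvd hxprime hxy hzxy hyx
      ⟨-z, by ring⟩ ⟨-x ^ 2, by ring⟩ ⟨-x * y, by ring⟩
      ⟨x ^ 4 - 3 * x * y * z + y ^ 3, by ring⟩ n hw (dvd_mul_right x w)
    rwa [mul_left_cancel₀ hx0 huw]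
  have hsJ : symbolicPower I n ≤ degreeTwoFiltration I d n :=
    symbolicPower_le hx hV (pow_le_degreeTwoFiltration n) hnzd
  have hJc : degreeTwoFiltration I d n ≤
      (I ^ n).colon ((IsLocalRing.maximalIdeal R ^ (n / 2) : Ideal R) : Set R) := by
    intro w hw
    refine Submodule.mem_colon.2 fun r hr => ?_
    refine degreeTwoFiltration_mul_pow_le (m := IsLocalRing.maximalIdeal R) ?_ n
      (Ideal.mul_mem_mul hw hr)
    rw [hI, hxyz]
    exact hrel.mul_maximal_le
  have hcs : (I ^ n).colon ((IsLocalRing.maximalIdeal R ^ (n / 2) : Ideal R) : Set R) ≤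
      symbolicPower I n := by
    intro s hs
    -- The denominator x^q works for every minimal prime p: if x were in p, then p would be 𝔪.
    refine mem_symbolicPower_iff.2 fun p hp => ⟨x ^ (n / 2), fun hxp => hmI ?_, ?_⟩
    · rw [← hV p hp.1.1 hp.1.2 (hp.1.1.mem_of_pow_mem _ hxp)]
      exact hp
    · rw [mul_comm]
      exact Submodule.mem_colon.1 hs _ (Ideal.pow_mem_pow hx _)
  have hcJ := le_antisymm hJc (hcs.trans hsJ)
  refine ⟨localDepth_pos_of_isSMulRegular hx ?_, le_antisymm (hsJ.trans hJc) hcs⟩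
  rw [← hcJ, isSMulRegular_iff_right_eq_zero_of_smul]
  intro m hm
  obtain ⟨w, rfl⟩ := Ideal.Quotient.mk_surjective m
  rw [← Ideal.Quotient.mk_eq_mk, ← Submodule.Quotient.mk_smul] at hm
  exact Ideal.Quotient.eq_zero_iff_mem.2 (hnzd w (Ideal.Quotient.eq_zero_iff_mem.1 hm))
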